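/- Let $H$ be a separable infinite-dimensional complex Hilbert space, let $\mathcal L=\mathcal L(H)$ be the space of bounded linear operators on $H$, and let $\mathbb D$ be the open unit disc in $\mathbb C$ with area measure $dA$. For a complex Banach space $Y$ and an analytic $f:\mathbb D\to Y$ write $\hat f(n)$ for its $n$th Taylor coefficient at $0$ and $(Df)(z)=zf'(z)+f(z)$, and put $$\|f\|_{H^2(Y)}=\sup_{0<r<1}\Big(\frac1{2\pi}\int_0^{2\pi}\|f(re^{i\theta})\|_Y^2\,d\theta\Big)^{1/2}\in[0,\infty].$$ Let $\mathcal O_1(H)$ be the set of analytic $f:\mathbb D\to H$ that extend analytically to a disc $\{|z|<R\}$ with $R>1$ and satisfy $\|f\|_{H^2(H)}=1$. For an analytic $\phi:\mathbb D\to\mathcal L$ and $f\in\mathcal O_1(H)$ let $$\Gamma_\phi f(z)=\sum_{n=0}^\infty\Big(\sum_{m=0}^\infty\hat\phi(m+n)\hat f(m)\Big)z^n,\qquad z\in\mathbb D,$$ and let $\phi^\#(z)=\phi(\bar z)^*$. Let $\mathrm{BMOA}_{\mathcal{NP}}(\mathcal L)$ be the class of analytic $\phi:\mathbb D\to\mathcal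 L$ for which $\Gamma_\phi$ is $H^2(H)$-bounded, i.e. $$\sup_{f\in\mathcal O_1(H)}\|\Gamma_\phi f\|_{H^2(H)}<\infty,$$ and let $\mathrm{BMOA}_{\mathcal C}(\mathcal L)$ be the class of analytic $\phi:\mathbb D\to\mathcal L$ that satisfy the anti-analytic Carleson embedding condition $$\sup_{f\in\mathcal O_1(H)}\int_{\mathbb D}\big\|(D\phi)(z)f(\bar z)\big\|_H^2\,(1-|z|^2)\,dA(z)<\infty.$$ Then $\mathrm{BMOA}_{\mathcal C}(\mathcal L)$ is not closed under the map $\phi\mapsto\phi^\#$. In particular $\mathrm{BMOA}_{\mathcal C}(\mathcal L)\neq\mathrm{BMOA}_{\mathcal{NP}}(\mathcal L)$; that is, it is not true that for every analytic $\phi:\mathbb D\to\mathcal L$ the operator $\Gamma_\phi$ is $H^2(H)$-bounded if and only if $\phi$ satisfies the anti-analytic Carleson embedding condition. -/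

import Mathlib

open MeasureTheory
open scoped ComplexConjugate ENNReal

namespace VecBMOA

noncomputable section

section Functions

variable {Y : Type*} [NormedAddCommGroup Y] [NormedSpace ℂ Y]

/-- `Hol Y`: the `Y`-valued analytic functions on the open unit disc. A function on the disc is
represented by a function on `ℂ`; its values outside the open unit disc are irrelevant, and nothing
below depends on them. -/
def Hol (Y : Type*) [NormedAddCommGroup Y] [NormedSpace ℂ Y] : Set (ℂ → Y) :=
  {f | AnalyticOnNhd ℂ f (Metric.ball 0 1)}

/-- `HolBar Y`: the functions in `Hol Y` that admit an analytic extension to a larger disc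
centred at the origin. -/
def HolBar (Y : Type*) [NormedAddCommGroup Y] [NormedSpace ℂ Y] : Set (ℂ → Y) :=
  {f | f ∈ Hol Y ∧ ∃ R : ℝ, 1 < R ∧ ∃ g : ℂ → Y,
    AnalyticOnNhd ℂ g (Metric.ball 0 R) ∧ Set.EqOn f g (Metric.ball 0 1)}

/-- The `n`-th Taylor coefficient of `f` at the origin. -/
def taylorCoeff (f : ℂ → Y) (n : ℕ) : Y :=
  ((n.factorial : ℂ)⁻¹) • iteratedDeriv n f 0

/-- The differentiation operator `D f (z) = z f'(z) + f(z)`. -/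
def D (f : ℂ → Y) : ℂ → Y := fun z => z • deriv f z + f z

/-- Normalized Lebesgue measure on the unit circle, in the parameter `θ ∈ (0, 2π]`. -/
def circleMeasure : Measure ℝ :=
  (ENNReal.ofReal (2 * Real.pi))⁻¹ • volume.restrict (Set.Ioc 0 (2 * Real.pi))

/-- The `H²`-norm: the supremum over `0 < r < 1` of the `L²`-norm over the unit circle of
`ζ ↦ f (r ζ)` (with value `∞` if `f` does not belong to `H²`). -/
def hardyNorm (f : ℂ → Y) : ℝ≥0∞ :=
  ⨆ r ∈ Set.Ioo (0 : ℝ) 1, eLpNorm (fun θ : ℝ => f (circleMap 0 r θ)) 2 circleMeasure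

/-- The `H²`-normalized functions in `HolBar Y`. -/
def HolBarOne (Y : Type*) [NormedAddCommGroup Y] [NormedSpace ℂ Y] : Set (ℂ → Y) :=
  {f | f ∈ HolBar Y ∧ hardyNorm f = 1}

end Functions

section Operators

variable {H : Type*} [NormedAddCommGroup H] [InnerProductSpace ℂ H]

/-- The Hankel operator with symbol `φ`:
`Γ_φ f (z) = ∑ₙ (∑ₘ φ̂(m+n) f̂(m)) zⁿ`. -/
def hankel (φ : ℂ → H →L[ℂ] H) (f : ℂ → H) : ℂ → H := fun z =>
  ∑' n : ℕ, z ^ n • ∑' m : ℕ, taylorCoeff φ (m + n) (taylorCoeff f m)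

/-- The Nehari--Page norm `sup_f ‖Γ_φ f‖`, over the normalized `f` in `HolBar H`. -/
def npNorm (φ : ℂ → H →L[ℂ] H) : ℝ≥0∞ :=
  ⨆ f ∈ HolBarOne H, hardyNorm (hankel φ f)

/-- The class `BMOA_NP`: the symbols of `H²(H)`-bounded Hankel operators. -/
def BMOANP (H : Type*) [NormedAddCommGroup H] [InnerProductSpace ℂ H] : Set (ℂ → H →L[ℂ] H) :=
  {φ | φ ∈ Hol (H →L[ℂ] H) ∧ npNorm φ < ∞}

/-- The square of the norm of `BMOA_C`, that is, the anti-analytic Carleson embedding constant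
`sup_f ∫ ‖(Dφ)(z) f(z̄)‖² (1 - |z|²) dA(z)`, over the normalized `f` in `HolBar H`, with `dA` area
measure on the open unit disc. -/
def carlesonNormSq (φ : ℂ → H →L[ℂ] H) : ℝ≥0∞ :=
  ⨆ f ∈ HolBarOne H, ∫⁻ z in Metric.ball (0 : ℂ) 1,
    ‖D φ z (f (conj z))‖ₑ ^ 2 * ENNReal.ofReal (1 - ‖z‖ ^ 2)

/-- The class `BMOA_C`: the anti-analytic Carleson embedding condition holds. -/
def BMOAC (H : Type*) [NormedAddCommGroup H] [InnerProductSpace ℂ H] : Set (ℂ → H →L[ℂ] H) :=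
  {φ | φ ∈ Hol (H →L[ℂ] H) ∧ carlesonNormSq φ < ∞}

/-- Coefficient conjugation `φ^#(z) = φ(z̄)^*`. -/
def sharp [CompleteSpace H] (φ : ℂ → H →L[ℂ] H) : ℂ → H →L[ℂ] H := fun z =>
  ContinuousLinearMap.adjoint (φ (conj z))

end Operators

end

end VecBMOA

/-! A single lacunary "row" symbol witnesses all three claims: with `b` orthonormal, φ(z)x = ∑ⱼ
z^(4^j) ⟪bⱼ, x⟫ b₀.

Carleson holds: writing fⱼ = ⟪bⱼ, f⟫, the integrand is |∑ⱼ (4^j+1) z^(4^j) fⱼ(z̄)|² (1-|z|²). A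
Schur test with weights 2^j (`tsum_mul_sq_le`) and the radial moments bound its integral by a kernel
decaying like 2^(-|i-j|) (`schur_kernel_le`) applied to ‖fⱼ‖², and ∑ⱼ ‖fⱼ‖² ≤ ‖f‖² by Bessel
(`tsum_hardyNorm_sq_le`).

Carleson fails for φ^#: this is the column symbol sending b₀ to ∑ⱼ z^(4^j) bⱼ. Tested on the
constant b₀, orthogonality leaves no cancellation, and each j contributes at least 1 to the integral
(`carlesonNormSq_sharp_rowSymbol`).

Γ_φ is unbounded: the normalized polynomial N^(-1/2) ∑_{j<N} z^(4^j) bⱼ is sent to the constant √N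
b₀ (`npNorm_rowSymbol`). -/

open Filter Topology

namespace VecBMOA

/-! ### Power series with coefficients bounded by 1 -/

section PowerSeries

variable {E : Type*} [NormedAddCommGroup E] [NormedSpace ℂ E]

lemma norm_lt_one_of_mem_ball {z : ℂ} (hz : z ∈ Metric.ball (0 : ℂ) 1) : ‖z‖ < 1 := by
  simpa using hz

/-- The sum of the power series with coefficients `a`. -/
noncomputable def powSeries (a : ℕ → E) : ℂ → E := fun z => ∑' n : ℕ, z ^ n • a n

variable [CompleteSpace E] {a : ℕ → E}

lemma hasSum_powSeries (ha : ∀ n, ‖a n‖ ≤ 1) {z : ℂ} (hz : ‖z‖ < 1) :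
    HasSum (fun n => z ^ n • a n) (powSeries a z) := by
  refine Summable.hasSum (.of_norm_bounded (summable_geometric_of_lt_one (norm_nonneg z) hz) ?_)
  intro n
  rw [norm_smul, norm_pow]
  exact mul_le_of_le_one_right (by positivity) (ha n)

lemma hasFPowerSeriesOnBall_powSeries (ha : ∀ n, ‖a n‖ ≤ 1) :
    HasFPowerSeriesOnBall (powSeries a)
      (fun n => ContinuousMultilinearMap.mkPiRing ℂ (Fin n) (a n)) 0 1 where
  r_le := by
    refine FormalMultilinearSeries.le_radius_of_bound _ 1 (r := 1) fun n => ?_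
    simpa using ha n
  r_pos := one_pos
  hasSum := by
    intro z hz
    have hz' : ‖z‖ < 1 := by
      rw [← ENNReal.ofReal_one, Metric.eball_ofReal] at hz
      exact norm_lt_one_of_mem_ball hz
    simpa using hasSum_powSeries ha hz'

lemma powSeries_mem_hol (ha : ∀ n, ‖a n‖ ≤ 1) : powSeries a ∈ Hol E := by
  have h := (hasFPowerSeriesOnBall_powSeries ha).analyticOnNhd
  rwa [← ENNReal.ofReal_one, Metric.eball_ofReal] at h

lemma taylorCoeff_powSeries (ha : ∀ n, ‖a n‖ ≤ 1) (n : ℕ) :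
    taylorCoeff (powSeries a) n = a n := by
  have h := (hasFPowerSeriesOnBall_powSeries ha).factorial_smul 1 n
  rw [iteratedFDeriv_apply_eq_iteratedDeriv_mul_prod, Finset.prod_const_one, one_smul] at h
  rw [taylorCoeff, ← h, ← Nat.cast_smul_eq_nsmul ℂ, smul_smul,
    inv_mul_cancel₀ (mod_cast n.factorial_ne_zero)]
  simp

lemma hasSum_D_powSeries (ha : ∀ n, ‖a n‖ ≤ 1) {z : ℂ} (hz : ‖z‖ < 1) :
    HasSum (fun n : ℕ => ((n + 1 : ℂ) * z ^ n) • a n) (D (powSeries a) z) := by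
  obtain ⟨r, hzr, hr1⟩ := exists_between hz
  have hr0 : 0 ≤ r := (norm_nonneg z).trans hzr.le
  have hu : Summable fun n : ℕ => (n : ℝ) * r ^ (n - 1) := by
    have := summable_geometric_of_lt_one hr0 hr1
    have h2 := summable_pow_mul_geometric_of_norm_lt_one 1 (r := r)
      (by rwa [Real.norm_of_nonneg hr0])
    rw [← summable_nat_add_iff 1]
    refine (h2.add this).congr fun n => ?_
    push_cast
    simp
    ring
  have hbound : ∀ (n : ℕ) (y : ℂ), y ∈ Metric.ball (0 : ℂ) r →
      ‖((n : ℂ) * y ^ (n - 1)) • a n‖ ≤ (n : ℝ) * r ^ (n - 1) := by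
    intro n y hy
    have hy' : ‖y‖ ≤ r := by simpa using (Metric.mem_ball.1 hy).le
    rw [norm_smul, norm_mul, norm_pow, Complex.norm_natCast]
    refine (mul_le_of_le_one_right (by positivity) (ha n)).trans ?_
    gcongr
  have hzb : z ∈ Metric.ball (0 : ℂ) r := by simpa using hzr
  have hd : HasDerivAt (powSeries a) (∑' n : ℕ, ((n : ℂ) * z ^ (n - 1)) • a n) z :=
    hasDerivAt_tsum_of_isPreconnected hu Metric.isOpen_ball
      (convex_ball (0 : ℂ) r).isPreconnected
      (fun n y _ => (hasDerivAt_pow n y).smul_const (a n)) hbound hzb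
      (hasSum_powSeries ha hz).summable hzb
  have hs : HasSum (fun n : ℕ => ((n : ℂ) * z ^ (n - 1)) • a n) (deriv (powSeries a) z) := by
    rw [hd.deriv]
    exact (Summable.of_norm_bounded hu fun n => hbound n z hzb).hasSum
  convert! (hs.const_smul z).add (hasSum_powSeries ha hz) using 1
  ext n
  rw [smul_smul, ← add_smul]
  congr 1
  cases n with
  | zero => simp
  | succ n => simp [pow_succ]; ring

end PowerSeries

/-! ### Circle means and the Hardy norm -/

section Circle

/-- By Parseval the mean is ∑ |aᵢ|² t^(2i), which increases with t ≥ 0. -/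
lemma circleAverage_sq_norm_polynomial_mono (p : Polynomial ℂ) {r s : ℝ} (hr : 0 ≤ r)
    (hrs : r ≤ s) :
    Real.circleAverage (fun z => ‖p.eval z‖ ^ 2) 0 r ≤
      Real.circleAverage (fun z => ‖p.eval z‖ ^ 2) 0 s := by
  have key : ∀ t : ℝ, Real.circleAverage (fun z => ‖p.eval z‖ ^ 2) 0 t =
      ∑ i ∈ p.support, (‖p.coeff i‖ * |t| ^ i) ^ 2 := by
    intro t
    have h := (p.comp (Polynomial.C (t : ℂ) * Polynomial.X)).sum_sq_norm_coeff_eq_circleAverage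
    rw [Real.circleAverage_eq_circleAverage_zero_one (R := t)]
    simp only [Polynomial.eval_comp, Polynomial.eval_mul, Polynomial.eval_C, Polynomial.eval_X]
      at h
    simp only [add_zero]
    rw [← h]
    simp only [Polynomial.comp_C_mul_X_coeff, norm_mul, norm_pow, Complex.norm_real,
      Real.norm_eq_abs]
    refine Finset.sum_subset (fun i hi => ?_) fun i hi hi' => ?_
    · simp only [Polynomial.mem_support_iff, Polynomial.comp_C_mul_X_coeff] at hi ⊢
      exact left_ne_zero_of_mul hi
    · simp only [Polynomial.mem_support_iff, Polynomial.comp_C_mul_X_coeff, not_not] at hi'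
      rw [← norm_eq_zero, norm_mul, norm_pow, Complex.norm_real, Real.norm_eq_abs] at hi'
      rw [hi']; simp
  rw [key, key]
  gcongr

/-- Passes from the polynomial case to the limit: Taylor sums converge uniformly on the closed disc
of radius s < 1. -/
lemma circleAverage_sq_norm_mono {g : ℂ → ℂ} (hg : g ∈ Hol ℂ) {r s : ℝ} (hr : 0 ≤ r)
    (hrs : r ≤ s) (hs : s < 1) :
    Real.circleAverage (fun z => ‖g z‖ ^ 2) 0 r ≤ Real.circleAverage (fun z => ‖g z‖ ^ 2) 0 s := by
  have hs0 := hr.trans hrs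
  obtain ⟨R, hsR, hR⟩ := exists_between hs
  have hd : DifferentiableOn ℂ g (Metric.ball 0 1) := AnalyticOnNhd.differentiableOn hg
  have hR0 : 0 < R := hs0.trans_lt hsR
  lift R to NNReal using hR0.le
  have hps := (hd.mono (Metric.closedBall_subset_ball hR)).hasFPowerSeriesOnBall
    (by exact_mod_cast hR0)
  set q := cauchyPowerSeries g 0 R
  have hunif : TendstoUniformlyOn (fun n y => q.partialSum n y) g atTop (Metric.closedBall 0 s) := by
    obtain ⟨R', hsR', hR'⟩ := exists_between hsR
    lift R' to NNReal using hs0.trans hsR'.le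
    have := hps.tendstoUniformlyOn (r' := R') (by exact_mod_cast hR')
    simp only [zero_add] at this
    exact this.mono (Metric.closedBall_subset_ball hsR')
  let P : ℕ → Polynomial ℂ := fun n =>
    ∑ k ∈ Finset.range n, Polynomial.C (q.coeff k) * Polynomial.X ^ k
  have hP : ∀ n y, (P n).eval y = q.partialSum n y := by
    intro n y
    simp only [P, Polynomial.eval_finsetSum, FormalMultilinearSeries.partialSum,
      Polynomial.eval_mul, Polynomial.eval_C, Polynomial.eval_pow, Polynomial.eval_X,
      FormalMultilinearSeries.apply_eq_pow_smul_coeff, smul_eq_mul]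
    exact Finset.sum_congr rfl fun k _ => mul_comm _ _
  have hlim : ∀ t : ℝ, 0 ≤ t → t ≤ s → Tendsto
      (fun n => Real.circleAverage (fun z => ‖(P n).eval z‖ ^ 2) 0 t) atTop
      (𝓝 (Real.circleAverage (fun z => ‖g z‖ ^ 2) 0 t)) := by
    intro t ht hts
    have hmem : ∀ θ, circleMap 0 t θ ∈ Metric.closedBall (0 : ℂ) s := fun θ => by
      simpa [abs_of_nonneg ht] using hts
    have hgc : ContinuousOn g (Metric.closedBall 0 s) :=
      hd.continuousOn.mono (Metric.closedBall_subset_ball hs)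
    obtain ⟨C, hC⟩ := (isCompact_closedBall (0 : ℂ) s).exists_bound_of_continuousOn hgc
    simp only [Real.circleAverage]
    refine Tendsto.const_smul ?_ _
    refine intervalIntegral.tendsto_integral_filter_of_dominated_convergence
      -- C bounds g on the closed disc, and the partial sums are eventually within 1 of g.
      (fun _ => (C + 1) ^ 2) ?_ ?_ (by simp) ?_
    · refine Eventually.of_forall fun n => Continuous.aestronglyMeasurable ?_
      fun_prop
    · filter_upwards [Metric.tendstoUniformlyOn_iff.1 hunif 1 one_pos] with n hn
      refine Eventually.of_forall fun θ _ => ?_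
      rw [norm_pow, norm_norm, hP]
      have h1 := hn _ (hmem θ)
      have h2 := hC _ (hmem θ)
      rw [dist_eq_norm'] at h1
      gcongr
      calc ‖q.partialSum n (circleMap 0 t θ)‖
          ≤ ‖g (circleMap 0 t θ)‖ +
            ‖q.partialSum n (circleMap 0 t θ) - g (circleMap 0 t θ)‖ := norm_le_insert' _ _
        _ ≤ C + 1 := by gcongr
    · refine Eventually.of_forall fun θ _ => ?_
      simp only [hP]
      exact ((hunif.tendsto_at (hmem θ)).norm).pow 2
  exact le_of_tendsto_of_tendsto' (hlim r hr hrs) (hlim s hs0 le_rfl) fun n =>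
    circleAverage_sq_norm_polynomial_mono _ hr hrs

instance : IsProbabilityMeasure circleMeasure := by
  constructor
  have : (0 : ℝ) < 2 * Real.pi := by positivity
  simp only [circleMeasure, Measure.smul_apply, Measure.restrict_apply MeasurableSet.univ,
    Set.univ_inter, Real.volume_Ioc, sub_zero, smul_eq_mul]
  exact ENNReal.inv_mul_cancel (by simpa using this) ENNReal.ofReal_ne_top

variable {Y : Type*} [NormedAddCommGroup Y]

/-- The mean of `‖f‖²` over the circle of radius `r`. -/
noncomputable def sqMean (f : ℂ → Y) (r : ℝ) : ℝ≥0∞ :=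
  ∫⁻ θ, ‖f (circleMap 0 r θ)‖ₑ ^ 2 ∂circleMeasure

lemma eLpNorm_circle_sq (f : ℂ → Y) (r : ℝ) :
    eLpNorm (fun θ : ℝ => f (circleMap 0 r θ)) 2 circleMeasure ^ 2 = sqMean f r := by
  rw [eLpNorm_eq_lintegral_rpow_enorm_toReal (by simp) (by simp), ← ENNReal.rpow_natCast,
    ← ENNReal.rpow_mul]
  simp [sqMean]

lemma hardyNorm_sq (f : ℂ → Y) :
    hardyNorm f ^ 2 = ⨆ r ∈ Set.Ioo (0 : ℝ) 1, sqMean f r := by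
  have h := fun r => eLpNorm_circle_sq f r
  simp only [← h, hardyNorm]
  have : ∀ x : ℝ≥0∞, x ^ 2 = (ENNReal.orderIsoRpow 2 two_pos) x := fun x => by simp
  simp only [this, OrderIso.map_iSup]

lemma sqMean_le_hardyNorm_sq (f : ℂ → Y) {r : ℝ} (hr : r ∈ Set.Ioo (0 : ℝ) 1) :
    sqMean f r ≤ hardyNorm f ^ 2 := by
  rw [hardyNorm_sq]
  exact le_iSup₂ (f := fun r _ => sqMean f r) r hr

lemma hardyNorm_of_norm_eq {f : ℂ → Y} {u : ℝ → ℝ}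
    (h : ∀ r ∈ Set.Ioo (0 : ℝ) 1, ∀ θ, ‖f (circleMap 0 r θ)‖ = u r) :
    hardyNorm f = ⨆ r ∈ Set.Ioo (0 : ℝ) 1, ENNReal.ofReal (u r) := by
  refine biSup_congr fun r hr => ?_
  have hu : 0 ≤ u r := (h r hr 0) ▸ norm_nonneg _
  rw [eLpNorm_congr_norm_ae (g := fun _ => u r) (Eventually.of_forall fun θ => by
    rw [h r hr θ, Real.norm_of_nonneg hu]), eLpNorm_const _ (by simp) (NeZero.ne _)]
  simp [Real.enorm_of_nonneg hu]

variable [NormedSpace ℂ Y]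

lemma mem_ball_circleMap {r : ℝ} (hr : 0 ≤ r) (hr1 : r < 1) (θ : ℝ) :
    circleMap 0 r θ ∈ Metric.ball (0 : ℂ) 1 := by
  simpa [abs_of_nonneg hr] using hr1

lemma continuous_comp_circleMap {f : ℂ → Y} (hf : f ∈ Hol Y) {r : ℝ} (hr : 0 ≤ r) (hr1 : r < 1) :
    Continuous fun θ : ℝ => f (circleMap 0 r θ) :=
  (AnalyticOnNhd.continuousOn hf).comp_continuous (continuous_circleMap 0 r)
    (mem_ball_circleMap hr hr1)

lemma sqMean_eq_circleAverage {f : ℂ → Y} (hf : f ∈ Hol Y) {r : ℝ} (hr : 0 ≤ r) (hr1 : r < 1) :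
    sqMean f r = ENNReal.ofReal (Real.circleAverage (fun z => ‖f z‖ ^ 2) 0 r) := by
  have hpi : (0 : ℝ) < 2 * Real.pi := by positivity
  have hc := continuous_comp_circleMap hf hr hr1
  rw [sqMean, circleMeasure, lintegral_smul_measure, Real.circleAverage,
    intervalIntegral.integral_of_le hpi.le, smul_eq_mul, smul_eq_mul,
    ENNReal.ofReal_mul (p := (2 * Real.pi)⁻¹) (by positivity),
    ENNReal.ofReal_inv_of_pos hpi,
    ofReal_integral_eq_lintegral_ofReal]
  · congr 2
    ext θ
    rw [ENNReal.ofReal_pow (norm_nonneg _), ofReal_norm]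
  · exact ((hc.norm.pow 2).integrableOn_Icc (a := 0) (b := 2 * Real.pi)).mono_set
      Set.Ioc_subset_Icc_self
  · exact Eventually.of_forall fun θ => by positivity

lemma sqMean_mono {g : ℂ → ℂ} (hg : g ∈ Hol ℂ) {r s : ℝ} (hr : 0 ≤ r) (hrs : r ≤ s) (hs : s < 1) :
    sqMean g r ≤ sqMean g s := by
  rw [sqMean_eq_circleAverage hg hr (hrs.trans_lt hs),
    sqMean_eq_circleAverage hg (hr.trans hrs) hs]
  exact ENNReal.ofReal_le_ofReal (circleAverage_sq_norm_mono hg hr hrs hs)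

end Circle

/-! ### Bessel's inequality for the Hardy norm -/

section Orthonormal

variable {H : Type*} [NormedAddCommGroup H] [InnerProductSpace ℂ H]

lemma inner_comp_mem_hol {f : ℂ → H} (hf : f ∈ Hol H) (v : H) :
    (fun z => inner ℂ v (f z)) ∈ Hol ℂ :=
  fun z hz => ((innerSL ℂ v).analyticAt _).comp (hf z hz)

/-- Bessel holds at each point of each circle. The supremum over r commutes with finite sums because
the scalar circle means increase in r. -/
lemma tsum_hardyNorm_sq_le {ι : Type*} {b : ι → H} (hb : Orthonormal ℂ b) {f : ℂ → H}
    (hf : f ∈ Hol H) :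
    ∑' j, hardyNorm (fun z => inner ℂ (b j) (f z)) ^ 2 ≤ hardyNorm f ^ 2 := by
  rw [ENNReal.tsum_eq_iSup_sum]
  refine iSup_le fun s => ?_
  simp only [hardyNorm_sq, iSup_subtype']
  rw [ENNReal.finsetSum_iSup_of_monotone]
  · refine iSup_mono fun r => ?_
    simp only [sqMean]
    rw [← lintegral_finsetSum']
    · refine lintegral_mono fun θ => ?_
      have := hb.sum_inner_products_le (f (circleMap 0 r θ)) (s := s)
      simp only [← ofReal_norm, ← ENNReal.ofReal_pow (norm_nonneg _)]
      rw [← ENNReal.ofReal_sum_of_nonneg fun _ _ => by positivity]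
      exact ENNReal.ofReal_le_ofReal this
    · intro j _
      exact ((continuous_comp_circleMap (inner_comp_mem_hol hf (b j)) r.2.1.le
        r.2.2).enorm.measurable.pow_const 2).aemeasurable
  · intro j r s hrs
    exact sqMean_mono (inner_comp_mem_hol hf (b j)) r.2.1.le hrs s.2.2

end Orthonormal

/-! ### Polar coordinates and radial moments -/

section Polar

lemma setLIntegral_Ioc_eq_of_periodic {F : ℝ → ℝ≥0∞} {T : ℝ} (hF : Function.Periodic F T)
    (hT : 0 < T) (s t : ℝ) :
    ∫⁻ x in Set.Ioc s (s + T), F x = ∫⁻ x in Set.Ioc t (t + T), F x := by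
  have : VAddInvariantMeasure (AddSubgroup.zmultiples T) ℝ volume :=
    ⟨fun c s _ => measure_preimage_add _ _ _⟩
  exact IsAddFundamentalDomain.setLIntegral_eq (G := AddSubgroup.zmultiples T)
    (isAddFundamentalDomain_Ioc hT s) (isAddFundamentalDomain_Ioc hT t) F hF.map_vadd_zmultiples

/-- The conjugate in the Carleson integral becomes θ ↦ -θ, and periodicity reconciles the polar
range (-π, π) with the (0, 2π] of `circleMeasure`. -/
lemma lintegral_circle_neg {Y : Type*} [NormedAddCommGroup Y] (g : ℂ → Y) (r : ℝ) :
    ∫⁻ θ in Set.Ioo (-Real.pi) Real.pi, ‖g (circleMap 0 r (-θ))‖ₑ ^ 2 =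
      ENNReal.ofReal (2 * Real.pi) * sqMean g r := by
  have hpi : (0 : ℝ) < 2 * Real.pi := by positivity
  let F : ℝ → ℝ≥0∞ := fun θ => ‖g (circleMap 0 r θ)‖ₑ ^ 2
  have hF : Function.Periodic F (2 * Real.pi) := fun θ => by
    simp only [F, periodic_circleMap 0 r θ]
  have h1 : ∫⁻ θ in Set.Ioo (-Real.pi) Real.pi, F (-θ) =
      ∫⁻ θ in Set.Ioo (-Real.pi) Real.pi, F θ := by
    have := (Measure.measurePreserving_neg (volume : Measure ℝ)).setLIntegral_comp_preimage_emb
      (Homeomorph.neg ℝ).measurableEmbedding F (Set.Ioo (-Real.pi) Real.pi)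
    simpa using this
  have h2 := setLIntegral_Ioc_eq_of_periodic hF hpi (-Real.pi) 0
  rw [show -Real.pi + 2 * Real.pi = Real.pi by ring, zero_add] at h2
  change ∫⁻ θ in Set.Ioo (-Real.pi) Real.pi, F (-θ) = _
  rw [h1, restrict_Ioo_eq_restrict_Ioc, h2, sqMean, circleMeasure, lintegral_smul_measure,
    smul_eq_mul, ← mul_assoc, ENNReal.mul_inv_cancel (by simpa using hpi) ENNReal.ofReal_ne_top,
    one_mul]

lemma setLIntegral_ball_eq_polar (F : ℂ → ℝ≥0∞) :
    ∫⁻ z in Metric.ball (0 : ℂ) 1, F z =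
      ∫⁻ p : ℝ × ℝ, ENNReal.ofReal p.1 * F (circleMap 0 p.1 p.2)
        ∂((volume.restrict (Set.Ioo (0 : ℝ) 1)).prod
          (volume.restrict (Set.Ioo (-Real.pi) Real.pi))) := by
  rw [Measure.prod_restrict, ← Measure.volume_eq_prod,
    ← lintegral_indicator Metric.isOpen_ball.measurableSet,
    ← Complex.lintegral_comp_polarCoord_symm,
    show polarCoord.target = Set.Ioi (0 : ℝ) ×ˢ Set.Ioo (-Real.pi) Real.pi from rfl,
    ← lintegral_indicator (measurableSet_Ioi.prod measurableSet_Ioo),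
    ← lintegral_indicator (measurableSet_Ioo.prod measurableSet_Ioo)]
  congr 1
  ext ⟨r, θ⟩
  have hc : Complex.polarCoord.symm (r, θ) = circleMap 0 r θ := by
    rw [Complex.polarCoord_symm_apply, circleMap, Complex.exp_mul_I]
    simp
  by_cases hr : 0 < r <;> by_cases hr1 : r < 1 <;>
    by_cases hθ : θ ∈ Set.Ioo (-Real.pi) Real.pi <;>
    simp_all [Set.indicator, Set.mem_prod, abs_of_pos] <;> grind

lemma lintegral_radial (N : ℕ) :
    ∫⁻ r in Set.Ioo (0 : ℝ) 1, ENNReal.ofReal r * ENNReal.ofReal (r ^ N * (1 - r ^ 2)) =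
      ENNReal.ofReal (2 / ((N + 2) * (N + 4))) := by
  have h : ∫ r in (0 : ℝ)..1, (r ^ (N + 1) - r ^ (N + 3)) = 2 / ((N + 2) * (N + 4)) := by
    rw [intervalIntegral.integral_sub (by simp) (by simp), integral_pow, integral_pow]
    push_cast
    field_simp
    ring
  rw [← h, intervalIntegral.integral_of_le zero_le_one, ← restrict_Ioo_eq_restrict_Ioc,
    ofReal_integral_eq_lintegral_ofReal]
  · refine setLIntegral_congr_fun measurableSet_Ioo fun r hr => ?_
    rw [← ENNReal.ofReal_mul hr.1.le]
    congr 1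
    ring
  · exact ((by fun_prop : Continuous fun r : ℝ => r ^ (N + 1) - r ^ (N + 3)).integrableOn_Icc
      (a := 0) (b := 1)).mono_set Set.Ioo_subset_Icc_self
  · filter_upwards [ae_restrict_mem measurableSet_Ioo] with r hr
    have : r ^ (N + 3) ≤ r ^ (N + 1) := pow_le_pow_of_le_one hr.1.le hr.2.le (by omega)
    simpa using this

lemma setLIntegral_ball_radial (N : ℕ) :
    ∫⁻ z in Metric.ball (0 : ℂ) 1, ENNReal.ofReal (‖z‖ ^ N * (1 - ‖z‖ ^ 2)) =
      ENNReal.ofReal (2 * Real.pi) * ENNReal.ofReal (2 / ((N + 2) * (N + 4))) := by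
  rw [setLIntegral_ball_eq_polar, lintegral_prod _ (by fun_prop), ← lintegral_radial,
    ← lintegral_const_mul _ (by fun_prop)]
  refine setLIntegral_congr_fun measurableSet_Ioo fun r hr => ?_
  simp only [norm_circleMap_zero, abs_of_pos hr.1, lintegral_const, Measure.restrict_apply_univ,
    Real.volume_Ioo]
  rw [sub_neg_eq_add, ← two_mul, mul_comm]

/-- On each circle the mean of ‖g‖² is at most the squared Hardy norm, so only the radial moment
remains. -/
lemma setLIntegral_ball_radial_mul_le {Y : Type*} [NormedAddCommGroup Y] (g : ℂ → Y) (N : ℕ) :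
    ∫⁻ z in Metric.ball (0 : ℂ) 1,
        ENNReal.ofReal (‖z‖ ^ N * (1 - ‖z‖ ^ 2)) * ‖g (conj z)‖ₑ ^ 2 ≤
      ENNReal.ofReal (2 * Real.pi) * ENNReal.ofReal (2 / ((N + 2) * (N + 4))) *
        hardyNorm g ^ 2 := by
  rw [setLIntegral_ball_eq_polar, ← lintegral_radial, ← lintegral_const_mul _ (by fun_prop),
    ← lintegral_mul_const _ (by fun_prop)]
  -- The one-sided Tonelli inequality needs no measurability of g.
  refine (lintegral_prod_le _).trans (setLIntegral_mono' measurableSet_Ioo fun r hr => ?_)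
  have hconj : ∀ θ, conj (circleMap 0 r θ) = circleMap 0 r (-θ) := fun θ => by
    simp [circleMap, ← Complex.exp_conj]
  simp only [hconj, norm_circleMap_zero, abs_of_pos hr.1]
  simp_rw [← mul_assoc]
  rw [lintegral_const_mul' _ _ (ENNReal.mul_ne_top ENNReal.ofReal_ne_top ENNReal.ofReal_ne_top),
    lintegral_circle_neg, ← mul_assoc, mul_comm (_ * _) (ENNReal.ofReal (2 * Real.pi)), ← mul_assoc]
  gcongr
  exact sqMean_le_hardyNorm_sq g hr

end Polar

/-! ### The Schur test and its kernel -/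

section Schur

lemma two_mul_mul_le_sq_add_sq (a b : ℝ≥0∞) : 2 * (a * b) ≤ a ^ 2 + b ^ 2 := by
  induction a with
  | top => simp
  | coe a =>
    induction b with
    | top => simp
    | coe b => exact_mod_cast (mul_assoc 2 a b) ▸ two_mul_le_add_sq a b

/-- Expand the square, use 2yᵢyⱼ ≤ yᵢ² + yⱼ², and symmetrize the double sum. -/
lemma tsum_mul_sq_le {ι : Type*} (d y : ι → ℝ≥0∞) :
    (∑' j, d j * y j) ^ 2 ≤ ∑' j, ∑' i, d i * d j * y j ^ 2 := by
  have h2 : 2 * (∑' j, d j * y j) ^ 2 ≤ 2 * ∑' j, ∑' i, d i * d j * y j ^ 2 := by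
    calc 2 * (∑' j, d j * y j) ^ 2 = ∑' j, ∑' i, d i * d j * (2 * (y i * y j)) := by
          rw [sq, ← ENNReal.tsum_mul_left, ← ENNReal.tsum_mul_left]
          refine tsum_congr fun j => ?_
          rw [← ENNReal.tsum_mul_right, ← ENNReal.tsum_mul_left]
          exact tsum_congr fun i => by ring
      _ ≤ ∑' j, ∑' i, d i * d j * (y i ^ 2 + y j ^ 2) := by
          gcongr with j i
          exact two_mul_mul_le_sq_add_sq _ _
      _ = 2 * ∑' j, ∑' i, d i * d j * y j ^ 2 := by
          simp only [mul_add, ENNReal.tsum_add]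
          rw [ENNReal.tsum_comm, two_mul]
          congr 1
          exact tsum_congr fun j => tsum_congr fun i => by ring
  exact (ENNReal.mul_le_mul_iff_right two_ne_zero ENNReal.ofNat_ne_top).1 h2

/-- Two geometric series split at i = j: the part below j gives at most 1, the rest at most 2. -/
lemma tsum_ofReal_min_two_pow_div_le (j : ℕ) :
    ∑' i : ℕ, ENNReal.ofReal (min ((2 : ℝ) ^ i / 2 ^ j) (2 ^ j / 2 ^ i)) ≤ 3 := by
  rw [← ENNReal.summable.sum_add_tsum_nat_add' (k := j)
    (f := fun i : ℕ => ENNReal.ofReal (min ((2 : ℝ) ^ i / 2 ^ j) (2 ^ j / 2 ^ i)))]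
  have h1 : ∑ i ∈ Finset.range j, ENNReal.ofReal (min ((2 : ℝ) ^ i / 2 ^ j) (2 ^ j / 2 ^ i)) ≤ 1 := by
    calc _ ≤ ∑ i ∈ Finset.range j, ENNReal.ofReal ((2 : ℝ) ^ i / 2 ^ j) := by
          gcongr; exact min_le_left _ _
      _ ≤ 1 := by
          rw [← ENNReal.ofReal_sum_of_nonneg fun _ _ => by positivity, ← Finset.sum_div,
            geom_sum_eq (by norm_num), ENNReal.ofReal_le_one, div_le_one (by positivity)]
          norm_num
  have h2 : ∑' i : ℕ, ENNReal.ofReal (min ((2 : ℝ) ^ (i + j) / 2 ^ j) (2 ^ j / 2 ^ (i + j))) ≤ 2 := by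
    rw [← ENNReal.tsum_geometric_two]
    gcongr with i
    refine (ENNReal.ofReal_le_ofReal (min_le_right _ _)).trans_eq ?_
    rw [pow_add, ← ENNReal.ofReal_ofNat, ← ENNReal.ofReal_inv_of_pos two_pos,
      ← ENNReal.ofReal_pow (by positivity)]
    congr 1
    rw [inv_pow]
    field_simp
  calc _ ≤ (1 : ℝ≥0∞) + 2 := add_le_add h1 h2
    _ = 3 := by norm_num

/-- With u = 2^i and v = 2^j the left side is at most 8uv³/(u²+v²)². The bounds u/v and v/u then
follow from v⁴ ≤ (u²+v²)² and u²v² ≤ (u²+v²)². -/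
lemma schur_kernel_le (i j : ℕ) :
    ((4 : ℝ) ^ i + 1) / 2 ^ i * ((4 ^ j + 1) / 2 ^ j) * (2 ^ j) ^ 2 *
      (2 / (((4 ^ i + 4 ^ j : ℕ) + 2) * ((4 ^ i + 4 ^ j : ℕ) + 4))) ≤
      8 * min ((2 : ℝ) ^ i / 2 ^ j) (2 ^ j / 2 ^ i) := by
  have e : ∀ k : ℕ, (4 : ℝ) ^ k = (2 ^ k) ^ 2 := fun k => by
    rw [← pow_mul, mul_comm, pow_mul]; norm_num
  have hu : (1 : ℝ) ≤ 2 ^ i := one_le_pow₀ one_le_two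
  have hv : (1 : ℝ) ≤ 2 ^ j := one_le_pow₀ one_le_two
  push_cast
  rw [e, e]
  generalize (2 : ℝ) ^ i = u at *
  generalize (2 : ℝ) ^ j = v at *
  have hu0 : 0 < u := by linarith
  have hv0 : 0 < v := by linarith
  have hu2 : u ^ 2 + 1 ≤ 2 * u ^ 2 := by nlinarith
  have hv2 : v ^ 2 + 1 ≤ 2 * v ^ 2 := by nlinarith
  have step : (u ^ 2 + 1) / u * ((v ^ 2 + 1) / v) * v ^ 2 *
      (2 / ((u ^ 2 + v ^ 2 + 2) * (u ^ 2 + v ^ 2 + 4))) ≤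
      8 * (u * v ^ 3 / (u ^ 2 + v ^ 2) ^ 2) := by
    calc _ ≤ (2 * u ^ 2) / u * ((2 * v ^ 2) / v) * v ^ 2 *
        (2 / ((u ^ 2 + v ^ 2) * (u ^ 2 + v ^ 2))) := by
          have hw : 0 < u ^ 2 + v ^ 2 := by positivity
          generalize u ^ 2 + v ^ 2 = w at *
          gcongr <;> linarith
      _ = _ := by field_simp; ring
  refine step.trans ?_
  gcongr
  refine le_min ?_ ?_
  · rw [div_le_div_iff₀ (by positivity) hv0]
    nlinarith [mul_nonneg hu0.le (by positivity : 0 ≤ u ^ 4 + 2 * u ^ 2 * v ^ 2)]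
  · rw [div_le_div_iff₀ (by positivity) hu0]
    nlinarith [mul_nonneg hv0.le (by positivity : 0 ≤ u ^ 4 + u ^ 2 * v ^ 2 + v ^ 4)]

end Schur

/-! ### The row symbol satisfies the Carleson condition -/

section Symbol

variable {H : Type*} [NormedAddCommGroup H] [InnerProductSpace ℂ H]

lemma exists_orthonormal_nat (hH : ¬ FiniteDimensional ℂ H) : ∃ b : ℕ → H, Orthonormal ℂ b := by
  let B := Module.Free.chooseBasis ℂ H
  have : Infinite (Module.Free.ChooseBasisIndex ℂ H) := by
    rw [← not_finite_iff_infinite]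
    exact fun h => hH (Module.Finite.of_basis B)
  exact ⟨_, InnerProductSpace.gramSchmidtNormed_orthonormal
    (B.linearIndependent.comp _ (Infinite.natEmbedding _).injective)⟩

lemma hasSum_of_eq_single {ι E : Type*} [AddCommMonoid E] [TopologicalSpace E] {f : ι → E} {a : E}
    (k : ι) (hk : f k = a) (h : ∀ n, n ≠ k → f n = 0) : HasSum f a :=
  hk ▸ hasSum_single k h

lemma four_pow_injective : Function.Injective fun j : ℕ => 4 ^ j :=
  Nat.pow_right_injective (by norm_num)

/-- The rank one operator `x ↦ ⟪b j, x⟫ b 0`. -/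
noncomputable def rowOp (b : ℕ → H) (j : ℕ) : H →L[ℂ] H :=
  (innerSL ℂ (b j)).smulRight (b 0)

/-- The lacunary sequence of operators with `rowOp b j` in position `4 ^ j`. -/
noncomputable def rowCoeff (b : ℕ → H) : ℕ → H →L[ℂ] H :=
  Function.extend (fun j : ℕ => 4 ^ j) (rowOp b) 0

/-- The row symbol `φ(z) x = ∑ⱼ z ^ (4 ^ j) ⟪b j, x⟫ b 0`. -/
noncomputable def rowSymbol (b : ℕ → H) : ℂ → H →L[ℂ] H := powSeries (rowCoeff b)

variable {b : ℕ → H}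

@[simp] lemma rowOp_apply (j : ℕ) (x : H) : rowOp b j x = inner ℂ (b j) x • b 0 := rfl

lemma rowCoeff_four_pow (j : ℕ) : rowCoeff b (4 ^ j) = rowOp b j :=
  four_pow_injective.extend_apply _ _ _

lemma rowCoeff_eq_zero {n : ℕ} (hn : ¬ ∃ j : ℕ, 4 ^ j = n) : rowCoeff b n = 0 :=
  Function.extend_apply' _ _ _ hn

lemma norm_rowCoeff_le (hb : Orthonormal ℂ b) (n : ℕ) : ‖rowCoeff b n‖ ≤ 1 := by
  by_cases hn : ∃ j : ℕ, 4 ^ j = n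
  · obtain ⟨j, rfl⟩ := hn
    rw [rowCoeff_four_pow, rowOp, ContinuousLinearMap.norm_smulRight_apply, innerSL_apply_norm,
      hb.1, hb.1, one_mul]
  · simp [rowCoeff_eq_zero hn]

/-- If n ≠ 0, then 4^j + n is either no power of 4 or some 4^i with i ≠ j, where orthogonality kills
the value. -/
lemma rowCoeff_four_pow_add_apply (hb : Orthonormal ℂ b) (j n : ℕ) :
    rowCoeff b (4 ^ j + n) (b j) = if n = 0 then b 0 else 0 := by
  split_ifs with hn
  · subst hn
    rw [add_zero, rowCoeff_four_pow, rowOp_apply]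
    simp [inner_self_eq_norm_sq_to_K, hb.1]
  · by_cases h : ∃ i : ℕ, 4 ^ i = 4 ^ j + n
    · obtain ⟨i, hi⟩ := h
      have hij : i ≠ j := fun h => by subst h; omega
      rw [← hi, rowCoeff_four_pow, rowOp_apply, hb.2 hij, zero_smul]
    · simp [rowCoeff_eq_zero h]

/-- The lacunary polynomial `∑_{j < N} z ^ (4 ^ j) c b j`. -/
noncomputable def lacunaryPoly (b : ℕ → H) (c : ℝ) (N : ℕ) : ℂ → H :=
  fun z => ∑ j ∈ Finset.range N, (z ^ 4 ^ j * c) • b j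

lemma lacunaryPoly_eq_powSeries (c : ℝ) (N : ℕ) :
    lacunaryPoly b c N = powSeries fun n =>
      ∑ j ∈ Finset.range N, if n = 4 ^ j then (c : ℂ) • b j else 0 := by
  ext1 z
  refine (HasSum.tsum_eq ?_).symm
  simp only [lacunaryPoly, Finset.smul_sum]
  refine hasSum_sum fun j _ => ?_
  refine hasSum_of_eq_single (4 ^ j) ?_ ?_
  · simp only [if_true, smul_smul]
  · intro n hn
    simp [hn]

lemma norm_lacunaryPoly_sq (hb : Orthonormal ℂ b) (c : ℝ) (N : ℕ) (z : ℂ) :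
    ‖lacunaryPoly b c N z‖ ^ 2 = c ^ 2 * ∑ j ∈ Finset.range N, ‖z‖ ^ (2 * 4 ^ j) := by
  have h := hb.inner_sum (fun j => z ^ 4 ^ j * c) (fun j => z ^ 4 ^ j * c) (Finset.range N)
  rw [@norm_sq_eq_re_inner ℂ, lacunaryPoly, h, map_sum, Finset.mul_sum]
  refine Finset.sum_congr rfl fun j _ => ?_
  rw [Complex.conj_mul']
  simp only [norm_mul, norm_pow, Complex.norm_real, Real.norm_eq_abs]
  rw [← Complex.ofReal_pow, RCLike.re_to_complex, Complex.ofReal_re, mul_pow, sq_abs]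
  ring

variable [CompleteSpace H]

/-- The factor 4^j + 1 is split as ((4^j+1)/2^j) · 2^j to supply the two sequences of the Schur
test. -/
lemma enorm_D_rowSymbol_le (hb : Orthonormal ℂ b) {z : ℂ} (hz : ‖z‖ < 1) (x : H) :
    ‖D (rowSymbol b) z x‖ₑ ≤
      ∑' j : ℕ, ENNReal.ofReal ((4 ^ j + 1) / 2 ^ j * ‖z‖ ^ 4 ^ j) *
        (ENNReal.ofReal (2 ^ j) * ‖inner ℂ (b j) x‖ₑ) := by
  have hs := (hasSum_D_powSeries (norm_rowCoeff_le hb) hz).mapL (ContinuousLinearMap.apply ℂ H x)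
  have hs' := (four_pow_injective.hasSum_iff (by
    intro n hn
    simp [rowCoeff_eq_zero (b := b) (n := n) (by simpa using hn)])).2 hs
  have he : D (rowSymbol b) z x = ContinuousLinearMap.apply ℂ H x (D (powSeries (rowCoeff b)) z) :=
    rfl
  rw [he, ← hs'.tsum_eq]
  refine enorm_tsum_le_tsum_enorm.trans (ENNReal.tsum_le_tsum fun j => le_of_eq ?_)
  rw [← mul_assoc, ← ENNReal.ofReal_mul (by positivity)]
  have hn : ‖((4 : ℂ) ^ j + 1)‖ = 4 ^ j + 1 := by
    rw [show ((4 : ℂ) ^ j + 1) = ((4 ^ j + 1 : ℕ) : ℂ) by push_cast; rfl, Complex.norm_natCast]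
    push_cast; rfl
  simp only [Function.comp_apply, rowCoeff_four_pow, ContinuousLinearMap.apply_apply,
    smul_apply, rowOp_apply]
  rw [enorm_smul, enorm_smul, ← ofReal_norm (b 0), hb.1, ENNReal.ofReal_one, mul_one,
    ← ofReal_norm (_ * _)]
  congr 2
  rw [norm_mul, norm_pow]
  push_cast
  rw [hn]
  field_simp

/-- In the constant, 2π is the angular length, 8 comes from the kernel bound and 3 from its row
sums. -/
lemma carlesonNormSq_rowSymbol_le (hb : Orthonormal ℂ b) :
    carlesonNormSq (rowSymbol b) ≤ ENNReal.ofReal (2 * Real.pi) * (8 * 3) := by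
  refine iSup₂_le fun f hf => ?_
  have hfh : f ∈ Hol H := hf.1.1
  set h : ℕ → ℝ≥0∞ := fun j => hardyNorm (fun z => inner ℂ (b j) (f z)) ^ 2
  let A : ℕ → ℕ → ℝ := fun i j => (4 ^ i + 1) / 2 ^ i * ((4 ^ j + 1) / 2 ^ j) * (2 ^ j) ^ 2
  let K : ℕ → ℂ → ℝ≥0∞ := fun N z => ENNReal.ofReal (‖z‖ ^ N * (1 - ‖z‖ ^ 2))
  let G : ℕ → ℂ → ℝ≥0∞ := fun j z => ‖inner ℂ (b j) (f (conj z))‖ₑ ^ 2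
  have hpt : ∀ z ∈ Metric.ball (0 : ℂ) 1,
      ‖D (rowSymbol b) z (f (conj z))‖ₑ ^ 2 * ENNReal.ofReal (1 - ‖z‖ ^ 2) ≤
        ∑' j, ∑' i, ENNReal.ofReal (A i j) * (K (4 ^ i + 4 ^ j) z * G j z) := by
    intro z hz
    have hz1 := norm_lt_one_of_mem_ball hz
    refine (mul_le_mul_left (pow_le_pow_left' (enorm_D_rowSymbol_le hb hz1 _) 2) _).trans ?_
    refine (mul_le_mul_left (tsum_mul_sq_le _ _) _).trans_eq ?_
    rw [← ENNReal.tsum_mul_right]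
    refine tsum_congr fun j => ?_
    rw [← ENNReal.tsum_mul_right]
    refine tsum_congr fun i => ?_
    have hz2 : 0 ≤ 1 - ‖z‖ ^ 2 := by nlinarith [norm_nonneg z]
    simp only [K, G, A, mul_pow]
    rw [← mul_assoc (ENNReal.ofReal _) (ENNReal.ofReal (‖z‖ ^ _ * _)), mul_right_comm,
      ← mul_assoc]
    congr 1
    rw [← ENNReal.ofReal_pow (by positivity), ← ENNReal.ofReal_mul (by positivity),
      ← ENNReal.ofReal_mul (by positivity), ← ENNReal.ofReal_mul (by positivity),
      ← ENNReal.ofReal_mul (by positivity)]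
    congr 1
    ring
  have hG : ∀ j, AEMeasurable (G j) (volume.restrict (Metric.ball (0 : ℂ) 1)) := by
    intro j
    have hc : ContinuousOn (fun z => inner ℂ (b j) (f (conj z))) (Metric.ball (0 : ℂ) 1) :=
      (AnalyticOnNhd.continuousOn (inner_comp_mem_hol hfh (b j))).comp
        Complex.continuous_conj.continuousOn fun z hz => by simpa using hz
    exact (hc.aemeasurable Metric.isOpen_ball.measurableSet).enorm.pow_const 2
  have hK : ∀ N, Measurable (K N) := fun N => by fun_prop
  calc ∫⁻ z in Metric.ball (0 : ℂ) 1,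
        ‖D (rowSymbol b) z (f (conj z))‖ₑ ^ 2 * ENNReal.ofReal (1 - ‖z‖ ^ 2)
      ≤ ∫⁻ z in Metric.ball (0 : ℂ) 1,
          ∑' j, ∑' i, ENNReal.ofReal (A i j) * (K (4 ^ i + 4 ^ j) z * G j z) :=
        setLIntegral_mono' Metric.isOpen_ball.measurableSet hpt
    _ = ∑' j, ∑' i, ENNReal.ofReal (A i j) *
          ∫⁻ z in Metric.ball (0 : ℂ) 1, K (4 ^ i + 4 ^ j) z * G j z := by
        have hm : ∀ i j, AEMeasurable
            (fun z => ENNReal.ofReal (A i j) * (K (4 ^ i + 4 ^ j) z * G j z))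
            (volume.restrict (Metric.ball (0 : ℂ) 1)) := fun i j =>
          ((hK _).aemeasurable.mul (hG j)).const_mul _
        rw [lintegral_tsum fun j => AEMeasurable.tsum fun i => hm i j]
        refine tsum_congr fun j => ?_
        rw [lintegral_tsum fun i => hm i j]
        exact tsum_congr fun i => lintegral_const_mul' _ _ ENNReal.ofReal_ne_top
    _ ≤ ∑' j, ∑' i, ENNReal.ofReal (2 * Real.pi) *
          (8 * ENNReal.ofReal (min ((2 : ℝ) ^ i / 2 ^ j) (2 ^ j / 2 ^ i))) * h j := by
        refine ENNReal.tsum_le_tsum fun j => ENNReal.tsum_le_tsum fun i => ?_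
        refine (mul_le_mul_right (setLIntegral_ball_radial_mul_le
          (fun z => inner ℂ (b j) (f z)) (4 ^ i + 4 ^ j)) _).trans ?_
        rw [← mul_assoc, mul_left_comm, ← ENNReal.ofReal_mul (by positivity)]
        gcongr
        rw [show (8 : ℝ≥0∞) = ENNReal.ofReal 8 by simp, ← ENNReal.ofReal_mul (by norm_num)]
        exact ENNReal.ofReal_le_ofReal (schur_kernel_le i j)
    _ ≤ ∑' j, ENNReal.ofReal (2 * Real.pi) * (8 * 3) * h j := by
        refine ENNReal.tsum_le_tsum fun j => ?_
        rw [ENNReal.tsum_mul_right, ENNReal.tsum_mul_left, ENNReal.tsum_mul_left]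
        gcongr
        exact tsum_ofReal_min_two_pow_div_le j
    _ ≤ ENNReal.ofReal (2 * Real.pi) * (8 * 3) := by
        rw [ENNReal.tsum_mul_left]
        refine mul_le_of_le_one_right' ((tsum_hardyNorm_sq_le hb hfh).trans ?_)
        rw [hf.2, one_pow]

lemma rowSymbol_mem_BMOAC (hb : Orthonormal ℂ b) : rowSymbol b ∈ BMOAC H :=
  ⟨powSeries_mem_hol (norm_rowCoeff_le hb), (carlesonNormSq_rowSymbol_le hb).trans_lt
    (ENNReal.mul_lt_top ENNReal.ofReal_lt_top (by norm_num))⟩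

end Symbol

/-! ### Failure for the column symbol and for the Hankel operator -/

section Negative

lemma hardyNorm_const {Y : Type*} [NormedAddCommGroup Y] (v : Y) : hardyNorm (fun _ : ℂ => v) = ‖v‖ₑ := by
  rw [hardyNorm_of_norm_eq (u := fun _ => ‖v‖) fun _ _ _ => rfl, ofReal_norm]
  exact biSup_const ⟨1 / 2, by norm_num, by norm_num⟩

variable {H : Type*} [NormedAddCommGroup H] [InnerProductSpace ℂ H] [CompleteSpace H] {b : ℕ → H}

lemma sharp_powSeries (a : ℕ → H →L[ℂ] H) :
    sharp (powSeries a) = powSeries fun n => ContinuousLinearMap.adjoint (a n) := by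
  ext1 z
  simp only [sharp, powSeries, ← ContinuousLinearMap.star_eq_adjoint]
  rw [tsum_star]
  refine tsum_congr fun n => ?_
  rw [star_smul]
  simp

lemma adjoint_rowOp_apply (j : ℕ) (x : H) :
    ContinuousLinearMap.adjoint (rowOp b j) x = inner ℂ (b 0) x • b j := by
  refine ext_inner_right ℂ fun y => ?_
  rw [ContinuousLinearMap.adjoint_inner_left, rowOp_apply, inner_smul_left, inner_smul_right,
    inner_conj_symm, mul_comm]

lemma inner_D_sharp_rowSymbol (hb : Orthonormal ℂ b) {z : ℂ} (hz : ‖z‖ < 1) (j : ℕ) :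
    inner ℂ (b j) (D (sharp (rowSymbol b)) z (b 0)) = (4 ^ j + 1) * z ^ 4 ^ j := by
  have ha : ∀ n, ‖ContinuousLinearMap.adjoint (rowCoeff b n)‖ ≤ 1 := fun n => by
    rw [LinearIsometryEquiv.norm_map]
    exact norm_rowCoeff_le hb n
  have hs := ((hasSum_D_powSeries ha hz).mapL (ContinuousLinearMap.apply ℂ H (b 0))).mapL
    (innerSL ℂ (b j))
  rw [rowSymbol, sharp_powSeries]
  refine hs.unique ?_
  refine hasSum_of_eq_single (4 ^ j) ?_ ?_
  · simp [rowCoeff_four_pow, adjoint_rowOp_apply, hb.1, inner_self_eq_norm_sq_to_K]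
  · intro n hn
    by_cases hn' : ∃ i : ℕ, 4 ^ i = n
    · obtain ⟨i, rfl⟩ := hn'
      have hij : j ≠ i := fun h => hn (h ▸ rfl)
      simp [rowCoeff_four_pow, adjoint_rowOp_apply, hb.2 hij]
    · simp [rowCoeff_eq_zero hn']

lemma analyticOnNhd_of_differentiable {f : ℂ → H} (hf : Differentiable ℂ f) (s : Set ℂ) :
    AnalyticOnNhd ℂ f s := fun z _ => hf.analyticAt z

lemma mem_HolBar_of_differentiable {f : ℂ → H} (hf : Differentiable ℂ f) : f ∈ HolBar H :=
  ⟨analyticOnNhd_of_differentiable hf _, 2, one_lt_two, f, analyticOnNhd_of_differentiable hf _,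
    fun _ _ => rfl⟩

lemma const_mem_HolBarOne {v : H} (hv : ‖v‖ = 1) : (fun _ : ℂ => v) ∈ HolBarOne H :=
  ⟨mem_HolBar_of_differentiable (differentiable_const v), by
    rw [hardyNorm_const, ← ofReal_norm, hv, ENNReal.ofReal_one]⟩

lemma carlesonNormSq_sharp_rowSymbol (hb : Orthonormal ℂ b) :
    carlesonNormSq (sharp (rowSymbol b)) = ∞ := by
  refine ENNReal.eq_top_of_forall_nnreal_le fun r => ?_
  obtain ⟨N, hN⟩ := exists_nat_ge r
  have hr : (r : ℝ≥0∞) ≤ N := by exact_mod_cast hN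
  refine hr.trans (le_trans ?_ (le_iSup₂ (f := fun f (_ : f ∈ HolBarOne H) =>
    ∫⁻ z in Metric.ball (0 : ℂ) 1, ‖D (sharp (rowSymbol b)) z (f (conj z))‖ₑ ^ 2 *
      ENNReal.ofReal (1 - ‖z‖ ^ 2)) _ (const_mem_HolBarOne (hb.1 0))))
  have hterm : ∀ j : ℕ, 1 ≤ ∫⁻ z in Metric.ball (0 : ℂ) 1, ENNReal.ofReal ((4 ^ j + 1) ^ 2) *
      ENNReal.ofReal (‖z‖ ^ (2 * 4 ^ j) * (1 - ‖z‖ ^ 2)) := by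
    intro j
    rw [lintegral_const_mul _ (by fun_prop), setLIntegral_ball_radial,
      ← ENNReal.ofReal_mul (by positivity), ← ENNReal.ofReal_mul (by positivity),
      ENNReal.one_le_ofReal]
    push_cast
    have h4 : (1 : ℝ) ≤ 4 ^ j := one_le_pow₀ (by norm_num)
    generalize (4 : ℝ) ^ j = u at *
    -- The j-th term equals π(u+1)/(u+2) ≥ π/2 > 1, so the sum over j diverges.
    have : (u + 1) ^ 2 * (2 * Real.pi * (2 / ((2 * u + 2) * (2 * u + 4)))) =
        Real.pi * ((u + 1) / (u + 2)) := by field_simp; ring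
    rw [this]
    have h2 : 1 / 2 ≤ (u + 1) / (u + 2) := by rw [div_le_div_iff₀ two_pos (by linarith)]; linarith
    nlinarith [Real.pi_gt_three]
  calc (N : ℝ≥0∞) = ∑ j ∈ Finset.range N, 1 := by simp
    _ ≤ ∑ j ∈ Finset.range N, ∫⁻ z in Metric.ball (0 : ℂ) 1, ENNReal.ofReal ((4 ^ j + 1) ^ 2) *
          ENNReal.ofReal (‖z‖ ^ (2 * 4 ^ j) * (1 - ‖z‖ ^ 2)) :=
        Finset.sum_le_sum fun j _ => hterm j
    _ = ∫⁻ z in Metric.ball (0 : ℂ) 1, ∑ j ∈ Finset.range N, ENNReal.ofReal ((4 ^ j + 1) ^ 2) *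
          ENNReal.ofReal (‖z‖ ^ (2 * 4 ^ j) * (1 - ‖z‖ ^ 2)) :=
        (lintegral_finsetSum _ fun j _ => by fun_prop).symm
    _ ≤ _ := by
        refine setLIntegral_mono' Metric.isOpen_ball.measurableSet fun z hz => ?_
        have hz1 := norm_lt_one_of_mem_ball hz
        have hz2 : 0 ≤ 1 - ‖z‖ ^ 2 := by nlinarith [norm_nonneg z]
        have hB := hb.sum_inner_products_le (D (sharp (rowSymbol b)) z (b 0))
          (s := Finset.range N)
        rw [← ofReal_norm, ← ENNReal.ofReal_pow (norm_nonneg _),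
          ← ENNReal.ofReal_mul (by positivity)]
        simp_rw [← ENNReal.ofReal_mul (sq_nonneg _)]
        rw [← ENNReal.ofReal_sum_of_nonneg fun _ _ => by positivity]
        refine ENNReal.ofReal_le_ofReal (le_trans (le_of_eq ?_)
          (mul_le_mul_of_nonneg_right hB hz2))
        rw [Finset.sum_mul]
        refine Finset.sum_congr rfl fun j _ => ?_
        have hn : ‖((4 : ℂ) ^ j + 1)‖ = 4 ^ j + 1 := by
          rw [show ((4 : ℂ) ^ j + 1) = ((4 ^ j + 1 : ℕ) : ℂ) by push_cast; rfl,
            Complex.norm_natCast]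
          push_cast; rfl
        rw [inner_D_sharp_rowSymbol hb hz1, norm_mul, norm_pow, hn]
        ring

lemma taylorCoeff_lacunaryPoly (hb : Orthonormal ℂ b) {c : ℝ} (hc : |c| ≤ 1) (N n : ℕ) :
    taylorCoeff (lacunaryPoly b c N) n =
      ∑ j ∈ Finset.range N, if n = 4 ^ j then (c : ℂ) • b j else 0 := by
  rw [lacunaryPoly_eq_powSeries, taylorCoeff_powSeries]
  intro n
  by_cases hn : ∃ i : ℕ, 4 ^ i = n
  · obtain ⟨i, rfl⟩ := hn
    have : ∀ j, (4 ^ i = 4 ^ j) ↔ i = j := fun j => four_pow_injective.eq_iff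
    simp only [this, Finset.sum_ite_eq]
    split_ifs
    · simpa [norm_smul, hb.1] using hc
    · simp
  · rw [Finset.sum_eq_zero]
    · simp
    · exact fun j _ => if_neg fun h => hn ⟨j, h.symm⟩

/-- Each of the N frequencies meets its own coefficient only at n = 0, contributing c b₀, and all
contributions point in the same direction. -/
lemma hankel_rowSymbol_lacunaryPoly (hb : Orthonormal ℂ b) {c : ℝ} (hc : |c| ≤ 1) (N : ℕ) :
    hankel (rowSymbol b) (lacunaryPoly b c N) = fun _ => ((N : ℂ) * c) • b 0 := by
  have hcoeff : ∀ n : ℕ, ∑' m : ℕ, taylorCoeff (rowSymbol b) (m + n)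
      (taylorCoeff (lacunaryPoly b c N) m) = if n = 0 then ((N : ℂ) * c) • b 0 else 0 := by
    intro n
    refine HasSum.tsum_eq ?_
    simp only [rowSymbol, taylorCoeff_powSeries (norm_rowCoeff_le hb),
      taylorCoeff_lacunaryPoly hb hc, map_sum]
    have : (if n = 0 then ((N : ℂ) * c) • b 0 else 0) =
        ∑ j ∈ Finset.range N, (c : ℂ) • rowCoeff b (4 ^ j + n) (b j) := by
      simp only [rowCoeff_four_pow_add_apply hb, Finset.sum_const, Finset.card_range,
        ← Nat.cast_smul_eq_nsmul ℂ, smul_smul]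
      split_ifs <;> simp
    rw [this]
    refine hasSum_sum fun j _ => ?_
    refine hasSum_of_eq_single (4 ^ j) ?_ ?_
    · simp
    · intro m hm
      simp [hm]
  ext1 z
  simp only [hankel, hcoeff]
  rw [tsum_eq_single 0 fun n hn => by simp [hn]]
  simp

/-- By Pythagoras the norm is constant on each circle. It increases with the radius and tends to 1,
which gives the supremum. -/
lemma lacunaryPoly_mem_HolBarOne (hb : Orthonormal ℂ b) {N : ℕ} (hN : 0 < N) :
    lacunaryPoly b (Real.sqrt N)⁻¹ N ∈ HolBarOne H := by
  have hN0 : (0 : ℝ) < N := by exact_mod_cast hN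
  refine ⟨mem_HolBar_of_differentiable (by unfold lacunaryPoly; fun_prop), ?_⟩
  let u : ℝ → ℝ := fun r =>
    Real.sqrt ((Real.sqrt N)⁻¹ ^ 2 * ∑ j ∈ Finset.range N, r ^ (2 * 4 ^ j))
  rw [hardyNorm_of_norm_eq (u := u)]
  · have hu1 : u 1 = 1 := by
      simp [u, inv_pow, Real.sq_sqrt hN0.le, hN0.ne']
    refine le_antisymm (iSup₂_le fun r hr => ?_) ?_
    · rw [← ENNReal.ofReal_one, ← hu1]
      refine ENNReal.ofReal_le_ofReal (Real.sqrt_le_sqrt ?_)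
      have := hr.1.le
      have := hr.2.le
      gcongr
    · have hcont : Tendsto (fun r => ENNReal.ofReal (u r)) (𝓝[<] 1) (𝓝 1) := by
        have : Continuous fun r => ENNReal.ofReal (u r) :=
          ENNReal.continuous_ofReal.comp (by fun_prop)
        simpa [hu1] using (this.tendsto 1).mono_left nhdsWithin_le_nhds
      refine le_of_tendsto hcont ?_
      filter_upwards [Ioo_mem_nhdsLT (zero_lt_one (α := ℝ))] with r hr
      exact le_iSup₂ (f := fun r (_ : r ∈ Set.Ioo (0 : ℝ) 1) => ENNReal.ofReal (u r)) r hr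
  · intro r hr θ
    rw [← Real.sqrt_sq (norm_nonneg (lacunaryPoly _ _ _ _)), norm_lacunaryPoly_sq hb,
      norm_circleMap_zero, abs_of_pos hr.1]

lemma npNorm_rowSymbol (hb : Orthonormal ℂ b) : npNorm (rowSymbol b) = ∞ := by
  refine ENNReal.eq_top_of_forall_nnreal_le fun r => ?_
  obtain ⟨M, hM⟩ := exists_nat_ge r
  -- A perfect square, so that √N = M + 1 exceeds the prescribed bound r.
  set N := (M + 1) ^ 2
  have hs : Real.sqrt (N : ℕ) = M + 1 := by
    simp only [N]
    push_cast
    exact Real.sqrt_sq (by positivity)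
  have hmem := lacunaryPoly_mem_HolBarOne hb (N := N) (by positivity)
  refine le_trans ?_ (le_iSup₂ (f := fun f (_ : f ∈ HolBarOne H) =>
    hardyNorm (hankel (rowSymbol b) f)) _ hmem)
  rw [hankel_rowSymbol_lacunaryPoly hb, hardyNorm_const, ← ofReal_norm, norm_smul, hb.1, hs]
  · have : ‖((N : ℕ) : ℂ) * (((M + 1 : ℝ)⁻¹ : ℝ) : ℂ)‖ = M + 1 := by
      rw [norm_mul, Complex.norm_natCast, Complex.norm_real, Real.norm_of_nonneg (by positivity)]
      simp only [N]
      push_cast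
      field_simp
    rw [this, mul_one, ← ENNReal.ofReal_coe_nnreal]
    refine ENNReal.ofReal_le_ofReal ?_
    have : (r : ℝ) ≤ M := by exact_mod_cast hM
    linarith
  · rw [hs, abs_of_nonneg (by positivity)]
    exact inv_le_one_of_one_le₀ (by linarith [(Nat.cast_nonneg M : (0 : ℝ) ≤ M)])

end Negative

end VecBMOA

theorem mainTheorem4 (H : Type*) [NormedAddCommGroup H] [InnerProductSpace ℂ H] [CompleteSpace H]
    [TopologicalSpace.SeparableSpace H] (hH : ¬ FiniteDimensional ℂ H) :
    (¬ ∀ φ ∈ VecBMOA.BMOAC H, VecBMOA.sharp φ ∈ VecBMOA.BMOAC H) ∧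
    VecBMOA.BMOAC H ≠ VecBMOA.BMOANP H ∧
    (¬ ∀ φ ∈ VecBMOA.Hol (H →L[ℂ] H),
      (VecBMOA.npNorm φ < ⊤ ↔ VecBMOA.carlesonNormSq φ < ⊤)) := by
  obtain ⟨b, hb⟩ := VecBMOA.exists_orthonormal_nat hH
  have hC := VecBMOA.rowSymbol_mem_BMOAC hb
  have hNP := VecBMOA.npNorm_rowSymbol hb
  refine ⟨fun h => ?_, fun h => ?_, fun h => ?_⟩
  · exact (h _ hC).2.ne (VecBMOA.carlesonNormSq_sharp_rowSymbol hb)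
  · exact (h ▸ hC : VecBMOA.rowSymbol b ∈ VecBMOA.BMOANP H).2.ne hNP
  · exact ((h _ hC.1).2 hC.2).ne hNP
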